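/- Let $\mathbb U$ be the set of $n\times n$ complex unitary matrices $W$ such that $-1$ is not an eigenvalue of $W^{T}W$. Every $W\in\mathbb U$ has a unique factorization $W=W_1W_2$ in which $W_1$ is a real orthogonal matrix and $W_2$ is a unitary matrix with $W_2^{T}=W_2$ all of whose eigenvalues have positive real part. Let $|||\cdot|||$ be any unitarily invariant norm on the $n\times n$ complex matrices. Then for every $W\in\mathbb U$ there are a constant $C$ and a neighbourhood of $W$ in $\mathbb U$, depending only on $W$ and on the norm, with the following property. Let $\theta_1,\dots,\theta_n\in\mathbb R$ be such that the spectrum of $W_2$ is $\{e^{i\theta_1},\dots,e^{i\theta_n}\}$, and let $(a_m)_{m\in\mathbb Z}$ be any absolutely summable sequence of complex numbers such that $$\sum_{m=-\infty}^{\infty}(-1)^m a_m e^{im\theta}=\frac1{1+e^{i\theta}}\qquad\text{for all }\theta=\theta_i-\theta_j,\ 1\le i,j\le n.$$ Then, for every $\tilde W$ in this neighbourhood, with corresponding factorization $\tilde W=\tilde W_1\tilde W_2$, and for $k=1,2$, $$|||\tilde W_k-W_k|||\le 2\Big(\sum_{m=-\infty}^{\infty}|a_m|\Big)\,|||\tilde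 W-W|||+C\,|||\tilde W-W|||^2 .$$ -/

import Mathlib

open scoped Topology

/-- `N` is a unitarily invariant norm on the `n × n` complex matrices: a definite (complex) seminorm
with `N (U A V) = N A` for all unitary `U`, `V`. -/
def IsUnitarilyInvariantNorm {n : ℕ} (N : Seminorm ℂ (Matrix (Fin n) (Fin n) ℂ)) : Prop :=
  (∀ A, N A = 0 → A = 0) ∧
    ∀ U ∈ Matrix.unitaryGroup (Fin n) ℂ, ∀ V ∈ Matrix.unitaryGroup (Fin n) ℂ,
      ∀ A, N (U * A * V) = N A

/-- The set `𝕌` of unitary matrices `W` such that `-1` is not an eigenvalue of `Wᵀ W`. -/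
def unitaryDomain (n : ℕ) : Set (Matrix (Fin n) (Fin n) ℂ) :=
  {W | W ∈ Matrix.unitaryGroup (Fin n) ℂ ∧ (-1 : ℂ) ∉ spectrum ℂ (W.transpose * W)}

/-- The real orthogonal matrices, regarded as complex matrices. -/
def realOrthogonal (n : ℕ) : Set (Matrix (Fin n) (Fin n) ℂ) :=
  {A | ∃ O ∈ Matrix.orthogonalGroup (Fin n) ℝ, A = O.map ((↑) : ℝ → ℂ)}

/-- The symmetric unitary matrices all of whose eigenvalues lie in the open right half plane. -/
def symmetricUnitaryPos (n : ℕ) : Set (Matrix (Fin n) (Fin n) ℂ) :=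
  {U | U ∈ Matrix.unitaryGroup (Fin n) ℂ ∧ U.transpose = U ∧ ∀ z ∈ spectrum ℂ U, 0 < z.re}

/-- `W = W₁ W₂` with `W₁` real orthogonal and `W₂` symmetric unitary with eigenvalues in the open
right half plane. -/
def IsUnitaryFactorization {n : ℕ} (W W₁ W₂ : Matrix (Fin n) (Fin n) ℂ) : Prop :=
  W₁ ∈ realOrthogonal n ∧ W₂ ∈ symmetricUnitaryPos n ∧ W = W₁ * W₂

/-! Since `W₁ᵀ W₁ = 1`, the factor `W₂` is a square root of `Wᵀ W`. This symmetric unitary matrix is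
diagonalized by a real orthogonal one, which gives existence by taking the roots of its eigenvalues
in the right half plane.

Uniqueness and the estimates rest on the Sylvester equation `Q X + X P = Y`: sums of eigenvalues of
`Q` and `P` have positive real part, so `X` is determined and bounded by `Y`, uniformly in `Q`.

For the estimates, multiply by `W₁ᵀ` to reach `W₁ = 1`, `W₂ = P`. With `K = O - 1`, `H = Q - P`, `E
= O Q - P`, orthogonality gives `Kᵀ = -K - Kᵀ K`. Comparing `E` with `Eᵀ`, modulo quadratic terms,
`P K + K P ≈ E - Eᵀ` and `P H + H P ≈ P E + Eᵀ P`. Each right side has norm at most `2 N E`, because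
`N` is transpose invariant. The series for the solution of `P X + X P = Y` contributes the factor `∑
|aₘ|`, and the Sylvester bound makes the remainder `O((N E)²)`. -/

section UnitaryFactorization

open Matrix

/-! ### Singular values and diagonal unitaries -/

open scoped ComplexOrder in
/-- The singular value decomposition of an invertible complex matrix. -/
theorem Matrix.exists_svd_of_isUnit {n : ℕ} {A : Matrix (Fin n) (Fin n) ℂ} (hA : IsUnit A) :
    ∃ U ∈ Matrix.unitaryGroup (Fin n) ℂ, ∃ V ∈ Matrix.unitaryGroup (Fin n) ℂ,
      ∃ d : Fin n → ℂ, A = U * diagonal d * V := by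
  have hpd : (Aᴴ * A).PosDef :=
    Matrix.PosDef.conjTranspose_mul_self A (Matrix.mulVec_injective_iff_isUnit.2 hA)
  set Z : Matrix (Fin n) (Fin n) ℂ := (hpd.1.eigenvectorUnitary : Matrix (Fin n) (Fin n) ℂ)
  set s := hpd.1.eigenvalues with hs
  have hZm : Z ∈ Matrix.unitaryGroup (Fin n) ℂ := hpd.1.eigenvectorUnitary.2
  have h1 : Z * star Z = 1 := Matrix.mem_unitaryGroup_iff.1 hZm
  have h2 : star Z * Z = 1 := Matrix.mem_unitaryGroup_iff'.1 hZm
  have hpos : ∀ i, 0 < √(s i) := fun i => Real.sqrt_pos.2 (hpd.eigenvalues_pos i)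
  have hdiag : star Z * (Aᴴ * A) * Z = diagonal (fun i => (s i : ℂ)) := by
    have h := hpd.1.spectral_theorem
    rw [Unitary.conjStarAlgAut_apply] at h
    change Aᴴ * A = Z * diagonal (fun i => (s i : ℂ)) * star Z at h
    rw [h]
    calc _ = (star Z * Z) * diagonal (fun i => (s i : ℂ)) * (star Z * Z) := by noncomm_ring
      _ = _ := by rw [h2]; simp
  have hinv : diagonal (fun i => ((√(s i) : ℝ) : ℂ)⁻¹) * diagonal (fun i => ((√(s i) : ℝ) : ℂ)) =
      (1 : Matrix (Fin n) (Fin n) ℂ) := by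
    rw [diagonal_mul_diagonal, ← diagonal_one]
    congr 1
    funext i
    exact inv_mul_cancel₀ (Complex.ofReal_ne_zero.2 (hpos i).ne')
  refine ⟨A * Z * diagonal (fun i => ((√(s i) : ℝ) : ℂ)⁻¹), ?_, star Z, ?_,
    fun i => ((√(s i) : ℝ) : ℂ), ?_⟩
  · rw [Matrix.mem_unitaryGroup_iff', star_eq_conjTranspose, conjTranspose_mul, conjTranspose_mul,
      diagonal_conjTranspose]
    calc _ = diagonal (star fun i => ((√(s i) : ℝ) : ℂ)⁻¹) * (star Z * (Aᴴ * A) * Z) *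
          diagonal (fun i => ((√(s i) : ℝ) : ℂ)⁻¹) := by
            rw [star_eq_conjTranspose]; simp only [Matrix.mul_assoc]
      _ = _ := by
        rw [hdiag, diagonal_mul_diagonal, diagonal_mul_diagonal, ← diagonal_one]
        congr 1
        funext i
        have h0 := Complex.ofReal_ne_zero.2 (hpos i).ne'
        have h3 : ((s i : ℝ) : ℂ) = (√(s i) : ℝ) * (√(s i) : ℝ) := by
          rw [← Complex.ofReal_mul, Real.mul_self_sqrt (hpd.eigenvalues_pos i).le]
        simp only [Pi.star_apply, star_inv₀, RCLike.star_def, Complex.conj_ofReal]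
        rw [h3]
        field_simp
  · exact Matrix.mem_unitaryGroup_iff.2 (by rw [star_star, h2])
  · rw [Matrix.mul_assoc (A * Z), hinv, Matrix.mul_one, Matrix.mul_assoc, h1, Matrix.mul_one]

theorem Matrix.diagonal_mem_unitaryGroup {n : ℕ} {d : Fin n → ℂ} (hd : ∀ i, ‖d i‖ = 1) :
    diagonal d ∈ Matrix.unitaryGroup (Fin n) ℂ := by
  rw [Matrix.mem_unitaryGroup_iff, star_eq_conjTranspose, diagonal_conjTranspose,
    diagonal_mul_diagonal, ← diagonal_one]
  congr 1
  funext i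
  simp [Complex.mul_conj, Complex.normSq_eq_norm_sq, hd i]

/-! ### Unitarily invariant norms: entries, products, transposes -/

namespace IsUnitarilyInvariantNorm

variable {n : ℕ} {N : Seminorm ℂ (Matrix (Fin n) (Fin n) ℂ)}

theorem mul_left (hN : IsUnitarilyInvariantNorm N) {U : Matrix (Fin n) (Fin n) ℂ}
    (hU : U ∈ Matrix.unitaryGroup (Fin n) ℂ) (A : Matrix (Fin n) (Fin n) ℂ) :
    N (U * A) = N A := by
  simpa using hN.2 U hU 1 (one_mem _) A

theorem mul_right (hN : IsUnitarilyInvariantNorm N) {U : Matrix (Fin n) (Fin n) ℂ}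
    (hU : U ∈ Matrix.unitaryGroup (Fin n) ℂ) (A : Matrix (Fin n) (Fin n) ℂ) :
    N (A * U) = N A := by
  simpa using hN.2 1 (one_mem _) U hU A

theorem le_sum_norm (N : Seminorm ℂ (Matrix (Fin n) (Fin n) ℂ)) (A : Matrix (Fin n) (Fin n) ℂ) :
    N A ≤ ∑ i, ∑ j, ‖A i j‖ * N (single i j 1) := by
  conv_lhs => rw [matrix_eq_sum_single A]
  refine (Finset.le_sum_of_subadditive N (map_zero N).le (map_add_le_add N) _ _).trans (Finset.sum_le_sum fun i _ => ?_)
  refine (Finset.le_sum_of_subadditive N (map_zero N).le (map_add_le_add N) _ _).trans (Finset.sum_le_sum fun j _ => ?_)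
  rw [← map_smul_eq_mul N, smul_single, smul_eq_mul, mul_one]

theorem continuous (N : Seminorm ℂ (Matrix (Fin n) (Fin n) ℂ)) : Continuous N := by
  refine continuous_iff_continuousAt.2 fun A => ?_
  refine tendsto_iff_dist_tendsto_zero.2 ?_
  have h : Filter.Tendsto (fun B : Matrix (Fin n) (Fin n) ℂ =>
      ∑ i, ∑ j, ‖(B - A) i j‖ * N (single i j 1)) (𝓝 A) (𝓝 0) := by
    have hc : Continuous (fun B : Matrix (Fin n) (Fin n) ℂ =>
      ∑ i, ∑ j, ‖(B - A) i j‖ * N (single i j 1)) := by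
      refine continuous_finsetSum _ fun i _ => continuous_finsetSum _ fun j _ => ?_
      exact (((continuous_id.sub continuous_const).matrix_elem i j).norm).mul continuous_const
    simpa using hc.tendsto A
  refine squeeze_zero (fun _ => dist_nonneg) (fun B => ?_) h
  refine le_trans ?_ (le_sum_norm N (B - A))
  rw [Real.dist_eq]
  exact abs_sub_map_le_sub N B A

/-- The projection onto a coordinate is the average of `1` and a diagonal sign matrix, both unitary.
-/
theorem row_le (hN : IsUnitarilyInvariantNorm N) (A : Matrix (Fin n) (Fin n) ℂ) (i : Fin n) :
    N (single i i 1 * A) ≤ N A := by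
  set D : Matrix (Fin n) (Fin n) ℂ := diagonal (fun k => if k = i then 1 else -1) with hD
  have hDu : D ∈ Matrix.unitaryGroup (Fin n) ℂ :=
    Matrix.diagonal_mem_unitaryGroup fun k => by split_ifs <;> simp
  have h : single i i 1 * A = (2⁻¹ : ℂ) • (A + D * A) := by
    have : single i i (1 : ℂ) = (2⁻¹ : ℂ) • (1 + D) := by
      ext k l
      by_cases hk : k = i <;> by_cases hl : k = l <;>
        simp_all [one_apply, eq_comm]; norm_num
    rw [this, smul_mul_assoc, add_mul, one_mul]
  rw [h, map_smul_eq_mul]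
  have := map_add_le_add N A (D * A)
  rw [hN.mul_left hDu] at this
  norm_num
  linarith

theorem col_le (hN : IsUnitarilyInvariantNorm N) (A : Matrix (Fin n) (Fin n) ℂ) (i : Fin n) :
    N (A * single i i 1) ≤ N A := by
  set D : Matrix (Fin n) (Fin n) ℂ := diagonal (fun k => if k = i then 1 else -1) with hD
  have hDu : D ∈ Matrix.unitaryGroup (Fin n) ℂ :=
    Matrix.diagonal_mem_unitaryGroup fun k => by split_ifs <;> simp
  have h : A * single i i 1 = (2⁻¹ : ℂ) • (A + A * D) := by
    have : single i i (1 : ℂ) = (2⁻¹ : ℂ) • (1 + D) := by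
      ext k l
      by_cases hk : k = i <;> by_cases hl : k = l <;>
        simp_all [one_apply, eq_comm]; norm_num
    rw [this, mul_smul_comm, mul_add, mul_one]
  rw [h, map_smul_eq_mul]
  have := map_add_le_add N A (A * D)
  rw [hN.mul_right hDu] at this
  norm_num
  linarith

theorem norm_entry_mul_le (hN : IsUnitarilyInvariantNorm N) (A : Matrix (Fin n) (Fin n) ℂ)
    (i j : Fin n) : ‖A i j‖ * N (single i j 1) ≤ N A := by
  have h : single i i 1 * A * single j j 1 = A i j • single i j (1 : ℂ) := by
    rw [single_mul_mul_single]; simp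
  rw [← map_smul_eq_mul N, ← h]
  exact (hN.col_le _ j).trans (hN.row_le A i)

theorem single_pos (hN : IsUnitarilyInvariantNorm N) (i j : Fin n) :
    0 < N (single i j 1) := by
  refine lt_of_le_of_ne (apply_nonneg N _) fun h => ?_
  have := congr_fun₂ (hN.1 _ h.symm) i j
  simp at this

/-- A unitarily invariant norm is compatible, up to a constant, with entrywise domination. -/
theorem exists_le_of_entry_le (hN : IsUnitarilyInvariantNorm N) :
    ∃ M : ℝ, 0 ≤ M ∧ ∀ (c : ℝ) (X Y : Matrix (Fin n) (Fin n) ℂ), 0 ≤ c →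
      (∀ i j, c * ‖X i j‖ ≤ ‖Y i j‖) → c * N X ≤ M * N Y := by
  refine ⟨∑ i : Fin n, ∑ j : Fin n, 1, by positivity, fun c X Y hc h => ?_⟩
  refine (mul_le_mul_of_nonneg_left (le_sum_norm N X) hc).trans ?_
  simp only [Finset.mul_sum, Finset.sum_mul, one_mul]
  refine Finset.sum_le_sum fun i _ => Finset.sum_le_sum fun j _ => ?_
  rw [← mul_assoc]
  exact (mul_le_mul_of_nonneg_right (h i j) (apply_nonneg N _)).trans (hN.norm_entry_mul_le Y i j)

/-- `N` is not assumed submultiplicative; `B` comes from bounding `N` above and each entry below by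
weighted entries. -/
theorem exists_mul_le (hN : IsUnitarilyInvariantNorm N) :
    ∃ B : ℝ, 0 ≤ B ∧ ∀ X Y : Matrix (Fin n) (Fin n) ℂ, N (X * Y) ≤ B * (N X * N Y) := by
  refine ⟨∑ i : Fin n, ∑ j : Fin n, (∑ k : Fin n,
    (N (single i k 1))⁻¹ * (N (single k j 1))⁻¹) * N (single i j 1), ?_, fun X Y => ?_⟩
  · have := fun i j : Fin n => hN.single_pos i j
    exact Finset.sum_nonneg fun i _ => Finset.sum_nonneg fun j _ => mul_nonneg
      (Finset.sum_nonneg fun k _ => mul_nonneg (inv_nonneg.2 (this i k).le)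
        (inv_nonneg.2 (this k j).le)) (this i j).le
  have hentry : ∀ (A : Matrix (Fin n) (Fin n) ℂ) i j, ‖A i j‖ ≤ (N (single i j 1))⁻¹ * N A :=
    fun A i j => by
      rw [inv_mul_eq_div, le_div_iff₀ (hN.single_pos i j)]
      exact hN.norm_entry_mul_le A i j
  refine (le_sum_norm N _).trans ?_
  rw [Finset.sum_mul]
  refine Finset.sum_le_sum fun i _ => ?_
  rw [Finset.sum_mul]
  refine Finset.sum_le_sum fun j _ => ?_
  rw [mul_right_comm]
  refine mul_le_mul_of_nonneg_right ?_ (apply_nonneg N _)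
  rw [mul_apply, Finset.sum_mul]
  refine (norm_sum_le _ _).trans (Finset.sum_le_sum fun k _ => ?_)
  rw [norm_mul, mul_mul_mul_comm]
  exact mul_le_mul (hentry X i k) (hentry Y k j) (norm_nonneg _)
    ((norm_nonneg _).trans (hentry X i k))

theorem transpose_of_isUnit (hN : IsUnitarilyInvariantNorm N) {A : Matrix (Fin n) (Fin n) ℂ}
    (hA : IsUnit A) : N Aᵀ = N A := by
  obtain ⟨U, hU, V, hV, d, rfl⟩ := Matrix.exists_svd_of_isUnit hA
  rw [hN.2 U hU V hV, transpose_mul, transpose_mul, diagonal_transpose, ← Matrix.mul_assoc]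
  exact hN.2 _ (transpose_mem_unitaryGroup_iff.2 hV) _ (transpose_mem_unitaryGroup_iff.2 hU) _

/-- For invertible `A` the singular value decompositions of `A` and `Aᵀ` share their diagonal. In
general `A - z` is invertible off a finite set of `z`, and continuity reaches `z = 0`. -/
theorem transpose (hN : IsUnitarilyInvariantNorm N) (A : Matrix (Fin n) (Fin n) ℂ) :
    N Aᵀ = N A := by
  have hc : Continuous fun z : ℂ => A - z • (1 : Matrix (Fin n) (Fin n) ℂ) := by fun_prop
  have hd : Dense ((A.charpoly.roots.toFinset : Set ℂ)ᶜ) :=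
    (Finset.countable_toSet _).dense_compl ℂ
  have h1 : Continuous fun z : ℂ => N (A - z • (1 : Matrix (Fin n) (Fin n) ℂ))ᵀ :=
    (continuous N).comp hc.matrix_transpose
  have h2 : Continuous fun z : ℂ => N (A - z • (1 : Matrix (Fin n) (Fin n) ℂ)) :=
    (continuous N).comp hc
  have h := congr_fun (h1.ext_on hd h2 fun z hz => hN.transpose_of_isUnit ?_) 0
  · simpa using h
  · by_contra hu
    apply hz
    have hz' : z ∈ spectrum ℂ A := by
      rw [spectrum.mem_iff, Algebra.algebraMap_eq_smul_one, ← IsUnit.neg_iff]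
      simpa using hu
    rw [Matrix.mem_spectrum_iff_isRoot_charpoly] at hz'
    simpa [A.charpoly_monic.ne_zero] using hz'

end IsUnitarilyInvariantNorm

/-! ### Real diagonalization and existence of the factorization -/

section Diagonalization

variable {n : ℕ}

theorem Matrix.map_ofReal_mul_transpose {R : Matrix (Fin n) (Fin n) ℝ}
    (hR : R ∈ Matrix.orthogonalGroup (Fin n) ℝ) :
    R.map ((↑) : ℝ → ℂ) * (R.map ((↑) : ℝ → ℂ))ᵀ = 1 := by
  have h := congr_arg (fun A : Matrix (Fin n) (Fin n) ℝ => A.map Complex.ofRealHom)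
    (Matrix.mem_orthogonalGroup_iff (Fin n) ℝ |>.1 hR)
  rw [Matrix.map_mul] at h
  refine h.trans ?_
  simp

theorem Matrix.star_map_ofReal (R : Matrix (Fin n) (Fin n) ℝ) :
    star (R.map ((↑) : ℝ → ℂ)) = (R.map ((↑) : ℝ → ℂ))ᵀ := by
  ext i j
  simp [star_apply]

theorem Matrix.map_ofReal_mem_unitaryGroup {R : Matrix (Fin n) (Fin n) ℝ}
    (hR : R ∈ Matrix.orthogonalGroup (Fin n) ℝ) :
    R.map ((↑) : ℝ → ℂ) ∈ Matrix.unitaryGroup (Fin n) ℂ := by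
  rw [Matrix.mem_unitaryGroup_iff, star_map_ofReal, map_ofReal_mul_transpose hR]

/-- A symmetric unitary matrix without the eigenvalue `-1` is the Cayley transform of a real
symmetric matrix, and hence diagonalized by a real orthogonal matrix. -/
theorem Matrix.exists_orthogonal_diagonalization {S : Matrix (Fin n) (Fin n) ℂ}
    (hS : S ∈ Matrix.unitaryGroup (Fin n) ℂ) (hT : Sᵀ = S) (h : (-1 : ℂ) ∉ spectrum ℂ S) :
    ∃ R ∈ Matrix.orthogonalGroup (Fin n) ℝ, ∃ t : Fin n → ℝ,
      S = R.map ((↑) : ℝ → ℂ) *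
        diagonal (fun i => (1 + t i * Complex.I) * (1 - t i * Complex.I)⁻¹) *
          (R.map ((↑) : ℝ → ℂ))ᵀ := by
  have hu : IsUnit (1 + S) := by
    rw [spectrum.notMem_iff, ← IsUnit.neg_iff] at h
    simpa [add_comm] using h
  have hdet : IsUnit (1 + S).det := (Matrix.isUnit_iff_isUnit_det _).1 hu
  set T := (1 + S)⁻¹ with hTdef
  have hT1 : (1 + S) * T = 1 := Matrix.mul_nonsing_inv _ hdet
  have hT2 : T * (1 + S) = 1 := Matrix.nonsing_inv_mul _ hdet
  have hTt : Tᵀ = T := by rw [hTdef, transpose_nonsing_inv, transpose_add, transpose_one, hT]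
  have hcomm : T * S = S * T := by
    have h1 : T + S * T = 1 := by simpa [add_mul] using hT1
    have h2 : T + T * S = 1 := by simpa [mul_add] using hT2
    exact add_left_cancel (h2.trans h1.symm)
  set A : Matrix (Fin n) (Fin n) ℂ := Complex.I • ((1 - S) * T) with hA
  have hAr : A * (1 + S) = Complex.I • (1 - S) := by
    rw [hA, smul_mul_assoc, Matrix.mul_assoc, hT2, Matrix.mul_one]
  have hAl : A = Complex.I • (T * (1 - S)) := by
    rw [hA, sub_mul, mul_sub, one_mul, mul_one, hcomm]
  have hAl' : (1 + S) * A = Complex.I • (1 - S) := by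
    rw [hAl, mul_smul_comm, ← Matrix.mul_assoc, hT1, Matrix.one_mul]
  have hAt : Aᵀ = A := by
    conv_rhs => rw [hAl]
    rw [hA, transpose_smul, transpose_mul, hTt, transpose_sub, transpose_one, hT]
  -- Both `star A` and `A` solve `X (1 + S) = i (1 - S)`. Being also symmetric, `A` has real
  -- entries.
  have hAs : star A = A := by
    have h1 : star A * (1 + S) = Complex.I • (1 - S) := by
      have h2 := congr_arg (fun X => star X * S) hAl'
      simp only [star_mul, star_add, star_one, star_smul, star_sub] at h2
      rw [Matrix.mul_assoc, add_mul, Matrix.mem_unitaryGroup_iff'.1 hS, one_mul,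
        smul_mul_assoc, sub_mul, Matrix.mem_unitaryGroup_iff'.1 hS, one_mul] at h2
      rw [add_comm, h2, ← neg_sub 1 S]
      simp only [RCLike.star_def, Complex.conj_I, neg_smul, smul_neg, neg_neg]
    calc star A = star A * (1 + S) * T := by rw [Matrix.mul_assoc, hT1, Matrix.mul_one]
      _ = A * (1 + S) * T := by rw [h1, hAr]
      _ = A := by rw [Matrix.mul_assoc, hT1, Matrix.mul_one]
  set B : Matrix (Fin n) (Fin n) ℝ := A.map Complex.re with hB
  have hBA : A = B.map ((↑) : ℝ → ℂ) := by
    ext i j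
    have h1 : (starRingEnd ℂ) (A i j) = A i j := by
      conv_lhs => rw [← hAt]
      exact congr_fun₂ hAs i j
    exact (Complex.conj_eq_iff_re.1 h1).symm
  have hBh : B.IsHermitian := by
    ext i j
    have := congr_fun₂ hAt i j
    simp only [transpose_apply] at this
    simp [hB, this]
  set R : Matrix (Fin n) (Fin n) ℝ :=
    (hBh.eigenvectorUnitary : Matrix (Fin n) (Fin n) ℝ) with hR
  have hRm : R ∈ Matrix.orthogonalGroup (Fin n) ℝ := hBh.eigenvectorUnitary.2
  set t := hBh.eigenvalues
  refine ⟨R, hRm, t, ?_⟩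
  set Z := R.map ((↑) : ℝ → ℂ) with hZ
  have hZ1 : Z * Zᵀ = 1 := map_ofReal_mul_transpose hRm
  have hZ2 : Zᵀ * Z = 1 := mul_eq_one_comm.1 hZ1
  have hAd : A = Z * diagonal (fun i => (t i : ℂ)) * Zᵀ := by
    have h1 : B = R * diagonal t * star R := by
      have h := hBh.spectral_theorem
      rw [Unitary.conjStarAlgAut_apply] at h
      exact h
    have h2 := congr_arg (fun A : Matrix (Fin n) (Fin n) ℝ => A.map Complex.ofRealHom) h1
    simp only [Matrix.map_mul] at h2
    rw [hBA]
    refine h2.trans ?_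
    congr 1
    congr 1
    rw [diagonal_map (by simp)]
    rfl
  have hD : ∀ z : ℂ, 1 + z • A = Z * diagonal (fun i => 1 + z * t i) * Zᵀ := fun z => by
    have : diagonal (fun i => 1 + z * t i) = 1 + z • diagonal (fun i => (t i : ℂ)) := by
      ext i j
      by_cases hij : i = j <;> simp [hij]
    rw [this, mul_add, add_mul, mul_one, hZ1, hAd, mul_smul_comm, smul_mul_assoc]
  have hne : ∀ i, 1 - t i * Complex.I ≠ 0 := fun i h0 => by
    have := congr_arg Complex.re h0
    simp at this
  -- Inverting the Cayley transform: `S = (1 + i A) (1 - i A)⁻¹`.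
  have hmain : S * (1 + (-Complex.I) • A) = 1 + Complex.I • A := by
    have h1 : A + S * A = Complex.I • (1 - S) := by simpa [add_mul] using hAl'
    have h2 : S * A = Complex.I • (1 - S) - A := eq_sub_of_add_eq' h1
    rw [mul_add, mul_one, mul_smul_comm, h2, smul_sub, smul_smul]
    simp only [neg_mul, Complex.I_mul_I, neg_neg, one_smul, neg_smul]
    abel
  have hinv : (diagonal fun i => 1 + -Complex.I * t i) *
      diagonal (fun i => (1 - t i * Complex.I)⁻¹) = (1 : Matrix (Fin n) (Fin n) ℂ) := by
    rw [diagonal_mul_diagonal, ← diagonal_one]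
    congr 1
    funext i
    rw [show 1 + -Complex.I * t i = 1 - t i * Complex.I by ring, mul_inv_cancel₀ (hne i)]
  rw [hD, hD] at hmain
  set D1 := diagonal fun i => 1 + -Complex.I * t i
  set D2 := diagonal (fun i => (1 - t i * Complex.I)⁻¹)
  calc S = S * (Z * (D1 * (Zᵀ * Z) * D2) * Zᵀ) := by rw [hZ2, mul_one, hinv, mul_one, hZ1, mul_one]
    _ = S * (Z * D1 * Zᵀ) * (Z * D2 * Zᵀ) := by simp only [Matrix.mul_assoc]
    _ = Z * (diagonal fun i => 1 + Complex.I * t i) * (Zᵀ * Z) * D2 * Zᵀ := by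
      rw [hmain]; simp only [Matrix.mul_assoc]
    _ = _ := by
      rw [hZ2, mul_one, Matrix.mul_assoc Z, diagonal_mul_diagonal]
      simp only [mul_comm Complex.I]

theorem Matrix.spectrum_unitary_conj_diagonal {Z : Matrix (Fin n) (Fin n) ℂ}
    (hZ : Z ∈ Matrix.unitaryGroup (Fin n) ℂ) (d : Fin n → ℂ) :
    spectrum ℂ (Z * diagonal d * star Z) = Set.range d := by
  have h := spectrum.units_conjugate (R := ℂ) (a := diagonal d)
    (u := Unitary.toUnits (⟨Z, hZ⟩ : Matrix.unitaryGroup (Fin n) ℂ))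
  rw [spectrum_diagonal] at h
  exact h

theorem neg_one_notMem_spectrum {P : Matrix (Fin n) (Fin n) ℂ}
    (hP : P ∈ symmetricUnitaryPos n) : (-1 : ℂ) ∉ spectrum ℂ P := fun h => by
  have := hP.2.2 _ h
  norm_num at this

theorem norm_cayley (t : ℝ) : ‖(1 + t * Complex.I) * (1 - t * Complex.I)⁻¹‖ = 1 := by
  have h1 : (starRingEnd ℂ) (1 + t * Complex.I) = 1 - t * Complex.I := by
    simp [sub_eq_add_neg]
  have h0 : 1 - t * Complex.I ≠ 0 := fun h0 => by
    have := congr_arg Complex.re h0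
    simp at this
  rw [norm_mul, norm_inv, ← h1, Complex.norm_conj, mul_inv_cancel₀]
  rw [← Complex.norm_conj, h1]
  exact norm_ne_zero_iff.2 h0

theorem exists_unitary_diagonalization {P : Matrix (Fin n) (Fin n) ℂ}
    (hP : P ∈ symmetricUnitaryPos n) :
    ∃ Z ∈ Matrix.unitaryGroup (Fin n) ℂ, ∃ d : Fin n → ℂ, P = Z * diagonal d * star Z ∧
      (∀ i, ‖d i‖ = 1) ∧ (∀ i, d i ∈ spectrum ℂ P) ∧ ∀ i, 0 < (d i).re := by
  obtain ⟨R, hR, t, h⟩ := Matrix.exists_orthogonal_diagonalization hP.1 hP.2.1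
    (neg_one_notMem_spectrum hP)
  have hZ := Matrix.map_ofReal_mem_unitaryGroup hR
  rw [← star_map_ofReal] at h
  have hs : ∀ i, (fun i => (1 + t i * Complex.I) * (1 - t i * Complex.I)⁻¹) i ∈ spectrum ℂ P :=
    fun i => by
      rw [h, spectrum_unitary_conj_diagonal hZ]
      exact Set.mem_range_self i
  exact ⟨_, hZ, _, h, fun i => norm_cayley _, hs, fun i => hP.2.2 _ (hs i)⟩

theorem spectrum_re_pos_exists_le {P : Matrix (Fin n) (Fin n) ℂ}
    (hP : P ∈ symmetricUnitaryPos n) : ∃ c : ℝ, 0 < c ∧ ∀ z ∈ spectrum ℂ P, c ≤ z.re := by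
  have hf : (spectrum ℂ P).Finite := Matrix.finite_spectrum P
  rcases (spectrum ℂ P).eq_empty_or_nonempty with h | h
  -- The spectrum is empty only for `n = 0`, where any positive constant serves.
  · exact ⟨1, one_pos, by simp [h]⟩
  · obtain ⟨z, hz, hmin⟩ := Set.exists_min_image _ Complex.re hf h
    exact ⟨z.re, hP.2.2 z hz, hmin⟩

theorem isUnitaryFactorization_exists {W : Matrix (Fin n) (Fin n) ℂ} (hW : W ∈ unitaryDomain n) :
    ∃ W₁ W₂, IsUnitaryFactorization W W₁ W₂ := by
  obtain ⟨hWu, hWs⟩ := hW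
  have hWtu := transpose_mem_unitaryGroup_iff.2 hWu
  obtain ⟨R, hR, t, h⟩ := Matrix.exists_orthogonal_diagonalization
    (mul_mem hWtu hWu) (by simp) hWs
  set Z := R.map ((↑) : ℝ → ℂ) with hZdef
  have hZ : Z ∈ Matrix.unitaryGroup (Fin n) ℂ := Matrix.map_ofReal_mem_unitaryGroup hR
  have hZs : star Z = Zᵀ := star_map_ofReal R
  have hZ1 : Z * Zᵀ = 1 := map_ofReal_mul_transpose hR
  have hZ2 : Zᵀ * Z = 1 := mul_eq_one_comm.1 hZ1
  set r : Fin n → ℝ := fun i => √(1 + t i ^ 2) with hr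
  have hrpos : ∀ i, 0 < r i := fun i => Real.sqrt_pos.2 (by positivity)
  -- The square root of `(1 + i t) / (1 - i t)` with positive real part.
  set d : Fin n → ℂ := fun i => (1 + t i * Complex.I) * ((r i : ℝ) : ℂ)⁻¹ with hd
  have hd2 : ∀ i, d i * d i = (1 + t i * Complex.I) * (1 - t i * Complex.I)⁻¹ := fun i => by
    have h0 : 1 - t i * Complex.I ≠ 0 := fun h0 => by
      have := congr_arg Complex.re h0
      simp at this
    have h1 : ((r i : ℝ) : ℂ) ≠ 0 := Complex.ofReal_ne_zero.2 (hrpos i).ne'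
    have h2 : ((r i : ℝ) : ℂ) ^ 2 = (1 + t i * Complex.I) * (1 - t i * Complex.I) := by
      rw [← Complex.ofReal_pow, hr, Real.sq_sqrt (by positivity)]
      push_cast
      linear_combination ((t i : ℂ) ^ 2) * Complex.I_sq
    simp only [hd]
    field_simp
    rw [h2]
    ring
  have hdn : ∀ i, ‖d i‖ = 1 := fun i => by
    have h1 : ‖d i‖ * ‖d i‖ = 1 := by rw [← norm_mul, hd2, norm_cayley]
    nlinarith [norm_nonneg (d i)]
  have hdre : ∀ i, 0 < (d i).re := fun i => by
    simp only [hd]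
    rw [← Complex.ofReal_inv, Complex.re_mul_ofReal]
    simpa using hrpos i
  set P : Matrix (Fin n) (Fin n) ℂ := Z * diagonal d * Zᵀ with hPdef
  have hPu : P ∈ Matrix.unitaryGroup (Fin n) ℂ :=
    mul_mem (mul_mem hZ (diagonal_mem_unitaryGroup hdn)) (transpose_mem_unitaryGroup_iff.2 hZ)
  have hPt : Pᵀ = P := by simp [hPdef, Matrix.mul_assoc]
  have hP2 : P * P = Wᵀ * W := by
    rw [h, hPdef]
    calc _ = Z * (diagonal d * (Zᵀ * Z) * diagonal d) * Zᵀ := by simp only [Matrix.mul_assoc]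
      _ = _ := by
        rw [hZ2, mul_one, diagonal_mul_diagonal]
        simp only [hd2]
  have hPs : P * star P = 1 := Matrix.mem_unitaryGroup_iff.1 hPu
  have hPs' : star P * P = 1 := Matrix.mem_unitaryGroup_iff'.1 hPu
  have hO : W * star P ∈ Matrix.unitaryGroup (Fin n) ℂ := mul_mem hWu (Unitary.star_mem hPu)
  have hsPt : (star P)ᵀ = star P := by
    conv_rhs => rw [← hPt]
    rfl
  have hOt : (W * star P)ᵀ * (W * star P) = 1 := by
    rw [transpose_mul, hsPt]
    calc _ = star P * (Wᵀ * W) * star P := by simp only [Matrix.mul_assoc]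
      _ = (star P * P) * (P * star P) := by rw [← hP2]; simp only [Matrix.mul_assoc]
      _ = 1 := by rw [hPs, hPs', one_mul]
  set O := W * star P with hOdef
  -- `O` is both unitary and complex orthogonal, hence real.
  have hOst : star O = Oᵀ := by
    calc star O = Oᵀ * O * star O := by rw [hOt, one_mul]
      _ = Oᵀ := by rw [Matrix.mul_assoc, Matrix.mem_unitaryGroup_iff.1 hO, mul_one]
  have hOre : O = (O.map Complex.re).map ((↑) : ℝ → ℂ) := by
    ext i j
    exact (Complex.conj_eq_iff_re.1 (congr_fun₂ hOst j i)).symm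
  refine ⟨O, P, ⟨O.map Complex.re, ?_, hOre⟩, ⟨hPu, hPt, fun z hz => ?_⟩, ?_⟩
  · rw [Matrix.mem_orthogonalGroup_iff']
    refine Matrix.map_injective Complex.ofReal_injective ?_
    have h1 : ((O.map Complex.re)ᵀ * O.map Complex.re).map Complex.ofRealHom = Oᵀ * O := by
      rw [Matrix.map_mul]
      conv_rhs => rw [hOre]
      rfl
    refine h1.trans (hOt.trans ?_)
    simp
  · rw [hPdef, ← hZs, spectrum_unitary_conj_diagonal hZ] at hz
    obtain ⟨i, rfl⟩ := hz
    exact hdre i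
  · rw [hOdef, Matrix.mul_assoc, hPs', mul_one]

end Diagonalization

/-! ### Sylvester equation and perturbation bounds -/

namespace IsUnitarilyInvariantNorm

variable {n : ℕ} {N : Seminorm ℂ (Matrix (Fin n) (Fin n) ℂ)}

/-- A bound for the solutions of the Sylvester equation `Q X + X P = Y`, uniform in `Q`. -/
theorem exists_sylvester_bound (hN : IsUnitarilyInvariantNorm N)
    {P : Matrix (Fin n) (Fin n) ℂ} (hP : P ∈ symmetricUnitaryPos n) :
    ∃ M : ℝ, 0 ≤ M ∧ ∀ Q ∈ symmetricUnitaryPos n, ∀ X : Matrix (Fin n) (Fin n) ℂ,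
      N X ≤ M * N (Q * X + X * P) := by
  obtain ⟨c, hc, hcP⟩ := spectrum_re_pos_exists_le hP
  obtain ⟨M, hM, hentry⟩ := hN.exists_le_of_entry_le
  refine ⟨c⁻¹ * M, by positivity, fun Q hQ X => ?_⟩
  obtain ⟨Z, hZ, d, hPd, -, hds, -⟩ := exists_unitary_diagonalization hP
  obtain ⟨Y, hY, e, hQe, -, -, hepos⟩ := exists_unitary_diagonalization hQ
  have hYs : star Y ∈ Matrix.unitaryGroup (Fin n) ℂ := Unitary.star_mem hY
  have h1 : star Y * (Q * X + X * P) * Z =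
      diagonal e * (star Y * X * Z) + (star Y * X * Z) * diagonal d := by
    rw [hQe, hPd]
    calc _ = (star Y * Y) * diagonal e * star Y * X * Z +
          star Y * X * Z * diagonal d * (star Z * Z) := by noncomm_ring
      _ = _ := by
        rw [Matrix.mem_unitaryGroup_iff'.1 hY, Matrix.mem_unitaryGroup_iff'.1 hZ]
        noncomm_ring
  -- In eigenbases the operator multiplies entry `(i, j)` by `e i + d j`, of modulus at least `c`.
  -- Only `P` determines `c`.
  have h2 := hentry c (star Y * X * Z) (star Y * (Q * X + X * P) * Z) hc.le fun i j => by
    rw [h1, Matrix.add_apply, diagonal_mul, mul_diagonal, mul_comm _ (d j), ← add_mul, norm_mul]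
    refine mul_le_mul_of_nonneg_right ?_ (norm_nonneg _)
    refine le_trans ?_ (Complex.re_le_norm _)
    rw [Complex.add_re]
    linarith [hepos i, hcP _ (hds j)]
  rw [hN.2 _ hYs _ hZ, hN.2 _ hYs _ hZ] at h2
  rw [mul_assoc, le_inv_mul_iff₀ hc]
  exact h2

theorem norm_le_tsum_mul {F : ℤ → Matrix (Fin n) (Fin n) ℂ} {X : Matrix (Fin n) (Fin n) ℂ}
    (hF : HasSum F X) {b : ℤ → ℝ} (hb : Summable b) (hb0 : ∀ m, 0 ≤ b m) {y : ℝ} (hy : 0 ≤ y)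
    (h : ∀ m, N (F m) ≤ b m * y) : N X ≤ (∑' m, b m) * y := by
  have hF' : Filter.Tendsto (fun s : Finset ℤ => ∑ m ∈ s, F m) Filter.atTop (𝓝 X) := hF
  refine le_of_tendsto (((continuous N).tendsto X).comp hF') (Filter.Eventually.of_forall fun s => ?_)
  refine (Finset.le_sum_of_subadditive N (map_zero N).le (map_add_le_add N) _ _).trans ?_
  refine (Finset.sum_le_sum fun m _ => h m).trans ?_
  rw [← Finset.sum_mul]
  exact mul_le_mul_of_nonneg_right (hb.sum_le_tsum s fun m _ => hb0 m) hy

/-- The solution of `P X + X P = Y` is `∑ (-1)ᵐ aₘ Pᵐ Y P⁻ᵐ⁻¹`. -/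
theorem exists_sylvester_solution (hN : IsUnitarilyInvariantNorm N)
    {P : Matrix (Fin n) (Fin n) ℂ} (hP : P ∈ symmetricUnitaryPos n)
    (Y : Matrix (Fin n) (Fin n) ℂ) :
    ∃ X, P * X + X * P = Y ∧ ∀ θ : Fin n → ℝ,
      spectrum ℂ P = Set.range (fun j => Complex.exp ((θ j : ℂ) * Complex.I)) →
      ∀ a : ℤ → ℂ, Summable (fun m => ‖a m‖) →
        (∀ i j : Fin n,
          HasSum (fun m : ℤ => (-1 : ℂ) ^ m * a m *
              Complex.exp ((m : ℂ) * ((θ i - θ j : ℝ) : ℂ) * Complex.I))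
            (1 / (1 + Complex.exp (((θ i - θ j : ℝ) : ℂ) * Complex.I)))) →
        N X ≤ (∑' m, ‖a m‖) * N Y := by
  obtain ⟨Z, hZ, d, hPd, -, hds, hdpos⟩ := exists_unitary_diagonalization hP
  have hZs : star Z ∈ Matrix.unitaryGroup (Fin n) ℂ := Unitary.star_mem hZ
  have hZ1 : Z * star Z = 1 := Matrix.mem_unitaryGroup_iff.1 hZ
  have hZ2 : star Z * Z = 1 := Matrix.mem_unitaryGroup_iff'.1 hZ
  have hne : ∀ i j, d i + d j ≠ 0 := fun i j h => by
    have := congr_arg Complex.re h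
    rw [Complex.add_re, Complex.zero_re] at this
    linarith [hdpos i, hdpos j]
  set Y' := star Z * Y * Z with hY'
  set X' : Matrix (Fin n) (Fin n) ℂ := Matrix.of fun i j => Y' i j / (d i + d j) with hX'
  have hX : diagonal d * X' + X' * diagonal d = Y' := by
    ext i j
    rw [Matrix.add_apply, diagonal_mul, mul_diagonal, mul_comm _ (d j), ← add_mul, hX',
      Matrix.of_apply, mul_div_cancel₀ _ (hne i j)]
  refine ⟨Z * X' * star Z, ?_, fun θ hθ a ha hsum => ?_⟩
  · rw [hPd]
    calc _ = Z * (diagonal d * (star Z * Z) * X' + X' * (star Z * Z) * diagonal d) * star Z := by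
          noncomm_ring
      _ = (Z * star Z) * Y * (Z * star Z) := by
        rw [hZ2, mul_one, mul_one, hX, hY']; noncomm_ring
      _ = Y := by rw [hZ1, one_mul, mul_one]
  · rw [hN.2 _ hZ _ hZs, ← hN.2 _ hZs _ hZ Y]
    -- Only the set of values `exp(iθ)` is prescribed, not order or multiplicity, so `σ` matches
    -- each `d i` with some angle.
    have hσ : ∀ i, ∃ k, Complex.exp ((θ k : ℂ) * Complex.I) = d i := fun i => by
      have := hds i
      rw [hθ] at this
      exact this
    choose σ hσ using hσ
    -- At integers `m`, `D m` is `Pᵐ` in the eigenbasis.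
    set D : ℝ → Matrix (Fin n) (Fin n) ℂ := fun x =>
      diagonal (fun i => Complex.exp (((x * θ (σ i) : ℝ) : ℂ) * Complex.I)) with hD
    have hDu : ∀ x, D x ∈ Matrix.unitaryGroup (Fin n) ℂ := fun x =>
      Matrix.diagonal_mem_unitaryGroup fun i => Complex.norm_exp_ofReal_mul_I _
    refine norm_le_tsum_mul
      (F := fun m : ℤ => ((-1 : ℂ) ^ m * a m) • (D m * Y' * D (-(m + 1)))) ?_ ha
      (fun m => norm_nonneg _) (apply_nonneg N _) fun m => ?_
    · refine Pi.hasSum.2 fun i => Pi.hasSum.2 fun j => ?_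
      have h := ((hsum (σ i) (σ j)).mul_right (Complex.exp (-((θ (σ j) : ℂ) * Complex.I)))).mul_right
        (Y' i j)
      have hterm : (fun m : ℤ => (-1 : ℂ) ^ m * a m *
          Complex.exp ((m : ℂ) * ((θ (σ i) - θ (σ j) : ℝ) : ℂ) * Complex.I) *
            Complex.exp (-((θ (σ j) : ℂ) * Complex.I)) * Y' i j) =
          fun m : ℤ => (((-1 : ℂ) ^ m * a m) • (D m * Y' * D (-(m + 1))) :
            Matrix (Fin n) (Fin n) ℂ) i j := by
        funext m
        simp only [hD, Matrix.smul_apply, diagonal_mul, mul_diagonal, smul_eq_mul]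
        have : Complex.exp (((m * θ (σ i) : ℝ) : ℂ) * Complex.I) *
            Complex.exp (((-(m + 1) * θ (σ j) : ℝ) : ℂ) * Complex.I) =
            Complex.exp ((m : ℂ) * ((θ (σ i) - θ (σ j) : ℝ) : ℂ) * Complex.I) *
            Complex.exp (-((θ (σ j) : ℂ) * Complex.I)) := by
          rw [← Complex.exp_add, ← Complex.exp_add]
          congr 1
          push_cast
          ring
        linear_combination (-((-1 : ℂ) ^ m * a m * Y' i j)) * this
      have hlim : 1 / (1 + Complex.exp (((θ (σ i) - θ (σ j) : ℝ) : ℂ) * Complex.I)) *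
          Complex.exp (-((θ (σ j) : ℂ) * Complex.I)) * Y' i j = X' i j := by
        have h1 : d i + d j = Complex.exp ((θ (σ j) : ℂ) * Complex.I) *
            (1 + Complex.exp (((θ (σ i) - θ (σ j) : ℝ) : ℂ) * Complex.I)) := by
          rw [mul_add, ← Complex.exp_add, mul_one, add_comm, ← hσ i, ← hσ j]
          congr 2
          push_cast
          ring
        rw [hX', Matrix.of_apply, h1, Complex.exp_neg, one_div, div_eq_mul_inv, _root_.mul_inv]
        ring
      rw [hterm, hlim] at h
      exact h
    · rw [map_smul_eq_mul, hN.2 _ (hDu _) _ (hDu _), norm_mul, norm_zpow, norm_neg, norm_one,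
        _root_.one_zpow, one_mul]

/-- The perturbation bounds near the factorization `1 * P`. -/
theorem exists_perturbation_bound (hN : IsUnitarilyInvariantNorm N)
    {P : Matrix (Fin n) (Fin n) ℂ} (hP : P ∈ symmetricUnitaryPos n) :
    ∃ C : ℝ, ∀ O ∈ Matrix.unitaryGroup (Fin n) ℂ, Oᵀ * O = 1 → ∀ Q ∈ symmetricUnitaryPos n,
      ∀ θ : Fin n → ℝ,
        spectrum ℂ P = Set.range (fun j => Complex.exp ((θ j : ℂ) * Complex.I)) →
      ∀ a : ℤ → ℂ, Summable (fun m => ‖a m‖) →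
        (∀ i j : Fin n,
          HasSum (fun m : ℤ => (-1 : ℂ) ^ m * a m *
              Complex.exp ((m : ℂ) * ((θ i - θ j : ℝ) : ℂ) * Complex.I))
            (1 / (1 + Complex.exp (((θ i - θ j : ℝ) : ℂ) * Complex.I)))) →
        N (O - 1) ≤ 2 * (∑' m, ‖a m‖) * N (O * Q - P) + C * N (O * Q - P) ^ 2 ∧
        N (Q - P) ≤ 2 * (∑' m, ‖a m‖) * N (O * Q - P) + C * N (O * Q - P) ^ 2 := by
  obtain ⟨M, hM, hsyl⟩ := hN.exists_sylvester_bound hP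
  obtain ⟨B, hB, hmul⟩ := hN.exists_mul_le
  set L := 1 + 2 * M with hL
  -- Three quadratic remainder terms, each at most `B (L N E)²`, pass through the Sylvester bound
  -- `M`.
  refine ⟨M * (3 * B * L ^ 2), fun O hO hOt Q hQ θ hθ a ha hsum => ?_⟩
  set E := O * Q - P with hE
  set K := O - 1 with hK
  set H := Q - P with hH
  have hPt : Pᵀ = P := hP.2.1
  have hQt : Qᵀ = Q := hQ.2.1
  have hHt : Hᵀ = H := by rw [hH, transpose_sub, hPt, hQt]
  have hKt : Kᵀ = -K - Kᵀ * K := by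
    have h1 : Oᵀ * O = (Kᵀ + 1) * (K + 1) := by simp [hK]
    rw [hOt] at h1
    have h2 : (Kᵀ + 1) * (K + 1) = Kᵀ * K + Kᵀ + K + 1 := by noncomm_ring
    rw [h2] at h1
    have h3 : Kᵀ * K + Kᵀ + K = 0 := by simpa using h1.symm
    rw [← sub_eq_zero, ← h3]
    abel
  have hEK : E = K * P + H + K * H := by rw [hE, hK, hH]; noncomm_ring
  have hEt : Eᵀ = P * Kᵀ + H + H * Kᵀ := by
    rw [hEK, transpose_add, transpose_add, transpose_mul, transpose_mul, hPt, hHt]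
  have hNE : 0 ≤ N E := apply_nonneg N _
  have hH0 : 0 ≤ N H := apply_nonneg N _
  have hK0 : 0 ≤ N K := apply_nonneg N _
  have hVt : (O * Q)ᵀ ∈ Matrix.unitaryGroup (Fin n) ℂ :=
    transpose_mem_unitaryGroup_iff.2 (mul_mem hO hQ.1)
  -- Both sides of the identity `h1` equal `Q² - P²`. As `M` is uniform in `Q`, no smallness of `E`
  -- is needed.
  have hHlip : N H ≤ 2 * M * N E := by
    have h1 : Q * H + H * P = (O * Q)ᵀ * E + Eᵀ * P := by
      rw [hE, transpose_sub, hPt, hH, transpose_mul, hQt]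
      have h2 : Q * Q = Q * (Oᵀ * O) * Q := by rw [hOt, mul_one]
      rw [mul_sub, h2]
      noncomm_ring
    have h3 := hsyl Q hQ H
    rw [h1] at h3
    have h4 := map_add_le_add N ((O * Q)ᵀ * E) (Eᵀ * P)
    rw [hN.mul_left hVt, hN.mul_right hP.1, hN.transpose] at h4
    nlinarith [mul_le_mul_of_nonneg_left h4 hM]
  have hHL : N H ≤ L * N E := by rw [hL]; nlinarith
  have hKL : N K ≤ L * N E := by
    have h1 : K * Q = E - H := by rw [hE, hK, hH]; noncomm_ring
    have h2 := map_sub_le_add N E H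
    rw [← h1, hN.mul_right hQ.1] at h2
    rw [hL]; nlinarith
  have hLE : 0 ≤ L * N E := hK0.trans hKL
  have hquad : ∀ X Y, N X ≤ L * N E → N Y ≤ L * N E → N (X * Y) ≤ B * (L * N E) ^ 2 :=
    fun X Y hX hY => by
      refine (hmul X Y).trans (mul_le_mul_of_nonneg_left ?_ hB)
      rw [sq]
      exact mul_le_mul hX hY (apply_nonneg N _) hLE
  have hKtL : N Kᵀ ≤ L * N E := by rwa [hN.transpose]
  have hKK := hquad _ _ hKtL hKL
  have hKH := hquad _ _ hKL hHL
  have hHK := hquad _ _ hHL hKtL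
  -- The sharp series bound handles the linear part `Y`; the crude bound `M` suffices for the
  -- remainder `R`.
  have key : ∀ X Y R, P * X + X * P = Y + R → N Y ≤ 2 * N E → N R ≤ 3 * B * (L * N E) ^ 2 →
      N X ≤ 2 * (∑' m, ‖a m‖) * N E + M * (3 * B * L ^ 2) * N E ^ 2 := by
    intro X Y R hXY hY hR
    obtain ⟨X₀, hX₀, hbound⟩ := hN.exists_sylvester_solution hP Y
    have h1 := hbound θ hθ a ha hsum
    have h2 : P * (X - X₀) + (X - X₀) * P = R := by
      rw [mul_sub, sub_mul, sub_add_sub_comm, hXY, hX₀, add_sub_cancel_left]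
    have h3 := hsyl P hP (X - X₀)
    rw [h2] at h3
    have h4 := map_add_le_add N X₀ (X - X₀)
    rw [add_sub_cancel] at h4
    have h5 : 0 ≤ ∑' m, ‖a m‖ := tsum_nonneg fun m => norm_nonneg _
    have h6 := mul_le_mul_of_nonneg_left hY h5
    have h7 := mul_le_mul_of_nonneg_left hR hM
    calc N X ≤ N X₀ + N (X - X₀) := h4
      _ ≤ (∑' m, ‖a m‖) * (2 * N E) + M * (3 * B * (L * N E) ^ 2) :=
        add_le_add (h1.trans h6) (h3.trans h7)
      _ = _ := by ring
  have htri : ∀ X Y Z, N (X + Y + Z) ≤ N X + N Y + N Z := fun X Y Z =>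
    (map_add_le_add N _ _).trans (add_le_add_left (map_add_le_add N X Y) _)
  constructor
  · refine key K (E - Eᵀ) (-(P * (Kᵀ * K)) + -(K * H) + H * Kᵀ) ?_ ?_ ?_
    · have h1 : E - Eᵀ = K * P + K * H - P * Kᵀ - H * Kᵀ := by
        rw [hEt]; conv_lhs => rw [hEK]
        abel
      have h2 : P * Kᵀ = -(P * K) - P * (Kᵀ * K) := by
        conv_lhs => rw [hKt]
        noncomm_ring
      rw [h1, h2]
      abel
    · refine (map_sub_le_add N _ _).trans ?_
      rw [hN.transpose]; linarith
    · refine (htri _ _ _).trans ?_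
      rw [map_neg_eq_map, map_neg_eq_map, hN.mul_left hP.1]
      linarith
  · refine key H (P * E + Eᵀ * P)
      (-(P * (K * H)) + P * (Kᵀ * K) * P + -(H * Kᵀ * P)) ?_ ?_ ?_
    · have h2 : P * Kᵀ = -(P * K) - P * (Kᵀ * K) := by
        conv_lhs => rw [hKt]
        noncomm_ring
      rw [hEt, h2]; conv_rhs => rw [hEK]
      noncomm_ring
    · refine (map_add_le_add N _ _).trans ?_
      rw [hN.mul_left hP.1, hN.mul_right hP.1, hN.transpose]; linarith
    · refine (htri _ _ _).trans ?_
      rw [map_neg_eq_map, map_neg_eq_map, hN.mul_left hP.1, hN.mul_right hP.1,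
        hN.mul_left hP.1, hN.mul_right hP.1]
      linarith

end IsUnitarilyInvariantNorm

/-! ### Uniqueness of the factorization -/

section Factorization

variable {n : ℕ}

theorem realOrthogonal_transpose_mul {A : Matrix (Fin n) (Fin n) ℂ} (hA : A ∈ realOrthogonal n) :
    Aᵀ * A = 1 := by
  obtain ⟨R, hR, rfl⟩ := hA
  exact mul_eq_one_comm.1 (map_ofReal_mul_transpose hR)

theorem realOrthogonal_mem_unitaryGroup {A : Matrix (Fin n) (Fin n) ℂ}
    (hA : A ∈ realOrthogonal n) : A ∈ Matrix.unitaryGroup (Fin n) ℂ := by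
  obtain ⟨R, hR, rfl⟩ := hA
  exact map_ofReal_mem_unitaryGroup hR

theorem IsUnitaryFactorization.transpose_mul_self {W W₁ W₂ : Matrix (Fin n) (Fin n) ℂ}
    (h : IsUnitaryFactorization W W₁ W₂) : Wᵀ * W = W₂ * W₂ := by
  obtain ⟨h1, h2, rfl⟩ := h
  rw [transpose_mul, h2.2.1]
  calc _ = W₂ * (W₁ᵀ * W₁) * W₂ := by simp only [Matrix.mul_assoc]
    _ = _ := by rw [realOrthogonal_transpose_mul h1, mul_one]

/-- Equal squares `V₂² = W₂²` make `V₂ - W₂` solve a homogeneous Sylvester equation, so it vanishes.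
-/
theorem IsUnitaryFactorization.unique {N : Seminorm ℂ (Matrix (Fin n) (Fin n) ℂ)}
    (hN : IsUnitarilyInvariantNorm N) {W W₁ W₂ V₁ V₂ : Matrix (Fin n) (Fin n) ℂ}
    (hW : IsUnitaryFactorization W W₁ W₂) (hV : IsUnitaryFactorization W V₁ V₂) :
    V₁ = W₁ ∧ V₂ = W₂ := by
  obtain ⟨M, -, h⟩ := hN.exists_sylvester_bound hW.2.1
  have h0 : V₂ * (V₂ - W₂) + (V₂ - W₂) * W₂ = 0 := by
    rw [mul_sub, sub_mul, ← hV.transpose_mul_self, ← hW.transpose_mul_self]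
    abel
  have h1 := h V₂ hV.2.1 (V₂ - W₂)
  rw [h0, map_zero, mul_zero] at h1
  have h2 : V₂ = W₂ := sub_eq_zero.1 (hN.1 _ (le_antisymm h1 (apply_nonneg N _)))
  refine ⟨?_, h2⟩
  have h3 : V₁ * W₂ = W₁ * W₂ := by rw [← hW.2.2, hV.2.2, h2]
  have h4 := Matrix.mem_unitaryGroup_iff.1 hW.2.1.1
  rw [← mul_one V₁, ← mul_one W₁, ← h4, ← mul_assoc, ← mul_assoc, h3]

end Factorization

end UnitaryFactorization

theorem proposition5p1 (n : ℕ) (N : Seminorm ℂ (Matrix (Fin n) (Fin n) ℂ))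
    (hN : IsUnitarilyInvariantNorm N)
    (W : Matrix (Fin n) (Fin n) ℂ) (hW : W ∈ unitaryDomain n) :
    (∃! P : Matrix (Fin n) (Fin n) ℂ × Matrix (Fin n) (Fin n) ℂ,
      IsUnitaryFactorization W P.1 P.2) ∧
    ∀ W₁ W₂ : Matrix (Fin n) (Fin n) ℂ, IsUnitaryFactorization W W₁ W₂ →
      ∃ C : ℝ, ∀ᶠ V in 𝓝[unitaryDomain n] W,
        ∀ V₁ V₂ : Matrix (Fin n) (Fin n) ℂ, IsUnitaryFactorization V V₁ V₂ →
        ∀ θ : Fin n → ℝ,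
          spectrum ℂ W₂ = Set.range (fun j => Complex.exp ((θ j : ℂ) * Complex.I)) →
        ∀ a : ℤ → ℂ, Summable (fun m => ‖a m‖) →
          (∀ i j : Fin n,
            HasSum (fun m : ℤ => (-1 : ℂ) ^ m * a m *
                Complex.exp ((m : ℂ) * ((θ i - θ j : ℝ) : ℂ) * Complex.I))
              (1 / (1 + Complex.exp (((θ i - θ j : ℝ) : ℂ) * Complex.I)))) →
          N (V₁ - W₁) ≤ 2 * (∑' m, ‖a m‖) * N (V - W) + C * N (V - W) ^ 2 ∧
          N (V₂ - W₂) ≤ 2 * (∑' m, ‖a m‖) * N (V - W) + C * N (V - W) ^ 2 := by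
  refine ⟨?_, fun W₁ W₂ hf => ?_⟩
  · obtain ⟨W₁, W₂, hf⟩ := isUnitaryFactorization_exists hW
    refine ⟨(W₁, W₂), hf, fun P hP => ?_⟩
    obtain ⟨h1, h2⟩ := IsUnitaryFactorization.unique hN hf hP
    exact Prod.ext h1 h2
  · obtain ⟨C, hC⟩ := hN.exists_perturbation_bound hf.2.1
    -- The estimate is global: every `V` qualifies, so any neighbourhood works.
    refine ⟨C, Filter.Eventually.of_forall fun V V₁ V₂ hV θ hθ a ha hsum => ?_⟩
    have hW1 := Matrix.transpose_mem_unitaryGroup_iff.2 (realOrthogonal_mem_unitaryGroup hf.1)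
    have hW1t := realOrthogonal_transpose_mul hf.1
    have hW1t' : W₁ * W₁.transpose = 1 := mul_eq_one_comm.1 hW1t
    have h := hC (W₁.transpose * V₁) (mul_mem hW1 (realOrthogonal_mem_unitaryGroup hV.1)) (by
      rw [Matrix.transpose_mul, Matrix.transpose_transpose, Matrix.mul_assoc,
        ← Matrix.mul_assoc W₁, hW1t', one_mul, realOrthogonal_transpose_mul hV.1])
      V₂ hV.2.1 θ hθ a ha hsum
    have h1 : W₁.transpose * V₁ * V₂ - W₂ = W₁.transpose * (V - W) := by
      rw [hV.2.2, hf.2.2, mul_sub, ← mul_assoc, ← mul_assoc, hW1t, one_mul]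
    have h2 : W₁.transpose * V₁ - 1 = W₁.transpose * (V₁ - W₁) := by rw [mul_sub, hW1t]
    rw [h1, h2, hN.mul_left hW1, hN.mul_left hW1] at h
    exact h
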